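/- Let $K$ be a non-empty compact metrizable space and let $\mathscr{K}$ be a collection of compact subsets of $K$ that is hereditary, i.e. every compact subset of an element of $\mathscr{K}$ belongs to $\mathscr{K}$. Assume that (i) for every non-empty open set $V \subseteq K$ there is a compact set $A \subseteq V$ such that, whenever $A_1, A_2, \ldots \in \mathscr{K}$, there is a compact set $L \notin \mathscr{K}$ with $L \subseteq A \setminus (A_1 \cup A_2 \cup \ldots)$; (ii) no compact set $A \subseteq K$ with $A \notin \mathscr{K}$ can be covered by countably many elements of $\mathscr{K}$. Then for every Borel map $f : K \to [0,1]$ there is a Borel set $B \subseteq K$ which cannot be covered by countably many elements of $\mathscr{K}$ and such that $f$ restricted to $B$ is either constant or injective. -/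

import Mathlib

open TopologicalSpace

/-- A collection of compact sets is hereditary if it is closed under taking compact subsets of its
elements. -/
def HereditaryCompacts {K : Type*} [TopologicalSpace K] (𝒦 : Set (Compacts K)) : Prop :=
  ∀ A ∈ 𝒦, ∀ B : Compacts K, (B : Set K) ⊆ (A : Set K) → B ∈ 𝒦

/-- The set `E` can be covered by countably many elements of `𝒦`. -/
def CountablyCoveredBy {K : Type*} [TopologicalSpace K] (𝒦 : Set (Compacts K)) (E : Set K) :
    Prop :=
  ∃ 𝒜 : Set (Compacts K), 𝒜.Countable ∧ 𝒜 ⊆ 𝒦 ∧ E ⊆ ⋃ A ∈ 𝒜, (A : Set K)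

open Set Filter Topology

/-! If some fibre has no countable cover by `𝒦`, it serves as `B`. Otherwise all fibres are meagre,
and `f` is continuous on a dense Gδ set `C`. A tree of shrinking open sets is built so that siblings
have disjoint `f`-images on `C` and every `A ∈ 𝒦` misses the closure of some child of each node. The
set of branch points is `B ⊆ C`: disjointness gives injectivity, and against a countable cover some
branch dodges the `k`-th set at level `k`. Children accumulate on a compact `L ∉ 𝒦`, which no `A ∈
𝒦` contains; `exists_compact_approached` finds `L` through the closed graph of `f` on `C`. -/

section Cover

variable {K : Type*} [TopologicalSpace K]

/-- A countable cover by elements of a family containing `∅` can be enumerated. -/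
theorem CountablyCoveredBy.exists_seq {𝒦 : Set (Compacts K)} {E : Set K}
    (h : CountablyCoveredBy 𝒦 E) (h0 : (⊥ : Compacts K) ∈ 𝒦) :
    ∃ a : ℕ → Compacts K, (∀ n, a n ∈ 𝒦) ∧ E ⊆ ⋃ n, (a n : Set K) := by
  obtain ⟨𝒜, hc, hs, hE⟩ := h
  obtain ⟨a, ha⟩ := (hc.insert ⊥).exists_eq_range (insert_nonempty _ _)
  refine ⟨a, fun n => ?_, fun x hx => ?_⟩
  · have : a n ∈ insert ⊥ 𝒜 := ha ▸ mem_range_self n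
    rcases this with h | h
    · exact h ▸ h0
    · exact hs h
  · obtain ⟨A, hA, hxA⟩ := mem_iUnion₂.1 (hE hx)
    have : A ∈ range a := ha ▸ mem_insert_of_mem _ hA
    obtain ⟨n, rfl⟩ := this
    exact mem_iUnion.2 ⟨n, hxA⟩

/-- If every non-empty open set contains a compact set outside a hereditary family `𝒦`, then sets
countably covered by `𝒦` are meagre. -/
theorem CountablyCoveredBy.isMeagre [T2Space K] {𝒦 : Set (Compacts K)} {E : Set K}
    (h : CountablyCoveredBy 𝒦 E) (hher : HereditaryCompacts 𝒦)
    (hV : ∀ V : Set K, IsOpen V → V.Nonempty → ∃ A : Compacts K, (A : Set K) ⊆ V ∧ A ∉ 𝒦) :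
    IsMeagre E := by
  obtain ⟨𝒜, hc, hs, hE⟩ := h
  refine (isMeagre_biUnion hc fun A hA => IsNowhereDense.isMeagre ?_).mono hE
  rw [A.isCompact.isClosed.isNowhereDense_iff]
  by_contra hne
  obtain ⟨B, hB, hBK⟩ := hV _ isOpen_interior (nonempty_iff_ne_empty.2 hne)
  exact hBK (hher A (hs hA) B (hB.trans interior_subset))

end Cover

/-- A Borel map is continuous on a dense `Gδ` set. -/
theorem Measurable.exists_dense_continuousOn {K Y : Type*} [TopologicalSpace K] [BaireSpace K]
    [MeasurableSpace K] [BorelSpace K] [TopologicalSpace Y] [SecondCountableTopology Y]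
    [MeasurableSpace Y] [OpensMeasurableSpace Y] {f : K → Y} (hf : Measurable f) :
    ∃ C : Set K, IsGδ C ∧ Dense C ∧ ContinuousOn f C := by
  have key : ∀ W ∈ countableBasis Y, ∃ u : Set K, IsOpen u ∧ f ⁻¹' W =ᶠ[residual K] u :=
    fun W hW => (hf (isOpen_of_mem_countableBasis hW).measurableSet).residualEq_isOpen
  choose! u huo hu using key
  have hres : {x | ∀ W ∈ countableBasis Y, (x ∈ f ⁻¹' W ↔ x ∈ u W)} ∈ residual K :=
    (eventually_countable_ball (countable_countableBasis Y)).2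
      fun W hW => (hu W hW).mem_iff
  obtain ⟨C, hC, hG, hD⟩ := mem_residual.1 hres
  refine ⟨C, hG, hD, fun x hx => ?_⟩
  refine (isBasis_countableBasis Y).nhds_hasBasis.tendsto_right_iff.2 fun W hW => ?_
  have hxu : x ∈ u W := (hC hx W hW.1).1 hW.2
  filter_upwards [inter_mem_nhdsWithin C ((huo W hW.1).mem_nhds hxu)] with y hy
  exact (hC hy.1 W hW.1).2 hy.2

section Scheme

variable {K Y : Type*} [TopologicalSpace K] [TopologicalSpace Y]

/-- Given a suitable map continuous on a dense set `C`, each non-empty open set contains a compact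
set `L ∉ 𝒦` such that every point of `L` is a limit of points of `C` whose values tend to a closed
set `Z` without belonging to it. -/
theorem exists_compact_approached [CompactSpace K] [MetrizableSpace K] [CompactSpace Y] [T2Space Y]
    {𝒦 : Set (Compacts K)}
    {V : Set K} (hV : V.Nonempty)
    (hi : ∃ A : Compacts K, (A : Set K) ⊆ V ∧
        ∀ a : ℕ → Compacts K, (∀ n, a n ∈ 𝒦) →
          ∃ L : Compacts K, L ∉ 𝒦 ∧ (L : Set K) ⊆ (A : Set K) \ ⋃ n, (a n : Set K))
    {f : K → Y} {C : Set K} (hC : C ∈ residual K) (hfC : ContinuousOn f C)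
    (hfib : ∀ c, IsMeagre (f ⁻¹' {c})) :
    ∃ (L : Compacts K) (Z : Set Y), L ∉ 𝒦 ∧ (L : Set K) ⊆ V ∧ IsClosed Z ∧
      ∀ l ∈ L, ∀ N : Set K, IsOpen N → l ∈ N → ∀ O : Set Y, IsOpen O → Z ⊆ O →
        ∃ x ∈ N ∩ C, f x ∈ O \ Z := by
  set Γ : Set (K × Y) := closure ((fun x => (x, f x)) '' C) with hΓ
  have hΓc : IsClosed Γ := isClosed_closure
  -- Either `Γ` has a horizontal section large enough to serve as `L`, or its horizontal sections in
  -- `A` all lie in `𝒦` and (i) avoids countably many of them.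
  by_cases hcase : ∃ (M : Compacts K) (c : Y), M ∉ 𝒦 ∧ (M : Set K) ⊆ V ∧ ∀ l ∈ M, (l, c) ∈ Γ
  · obtain ⟨M, c, hM, hMV, hMc⟩ := hcase
    refine ⟨M, {c}, hM, hMV, isClosed_singleton, fun l hl N hN hlN O hO hcO => ?_⟩
    obtain ⟨_, ⟨hx0N, hx0O⟩, x0, hx0, rfl⟩ := mem_closure_iff.1 (hMc l hl) (N ×ˢ O) (hN.prod hO)
      ⟨hlN, hcO rfl⟩
    obtain ⟨N', hN', hx0N', hsub⟩ := mem_nhdsWithin.1 (hfC x0 hx0 (hO.mem_nhds hx0O))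
    obtain ⟨x, ⟨hxN, hxN'⟩, hxC, hxc⟩ :=
      (dense_of_mem_residual (inter_mem hC (hfib c))).inter_open_nonempty
      (N ∩ N') (hN.inter hN') ⟨x0, hx0N, hx0N'⟩
    exact ⟨x, ⟨hxN, hxC⟩, hsub ⟨hxN', hxC⟩, hxc⟩
  · push Not at hcase
    obtain ⟨D, hDC, hDct, hDd⟩ := (dense_of_mem_residual hC).exists_countable_dense_subset
    have : Nonempty K := ⟨hV.some⟩
    obtain ⟨d, rfl⟩ := hDct.exists_eq_range hDd.nonempty
    obtain ⟨A, hAV, hA⟩ := hi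
    have hcl : ∀ c, IsClosed {x | (x, c) ∈ Γ} := fun c =>
      hΓc.preimage (Continuous.prodMk_left c)
    obtain ⟨L, hL, hLA⟩ := hA
      (fun n => ⟨A ∩ {x | (x, f (d n)) ∈ Γ}, A.isCompact.inter_right (hcl _)⟩) (fun n => by
        by_contra h
        obtain ⟨l, hl, hl'⟩ := hcase _ (f (d n)) h (inter_subset_left.trans hAV)
        exact hl' hl.2)
    refine ⟨L, Prod.snd '' (Γ ∩ ((L : Set K) ×ˢ univ)), hL,
      hLA.trans (sdiff_subset.trans hAV), ?_, fun l hl N hN hlN O hO hZO => ?_⟩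
    · exact (((L.isCompact.prod isCompact_univ).inter_left hΓc).image continuous_snd).isClosed
    · have hnot : ∀ n, f (d n) ∉ Prod.snd '' (Γ ∩ ((L : Set K) ×ˢ univ)) := by
        rintro n ⟨⟨x, y⟩, ⟨hxΓ, hx, -⟩, hxy⟩
        obtain rfl : y = f (d n) := hxy
        exact (hLA hx).2 (mem_iUnion.2 ⟨n, (hLA hx).1, hxΓ⟩)
      -- Otherwise `f (d n) ∉ O` whenever `d n ∈ N`; by compactness `Γ` then has a point over `l`
      -- outside `O ⊇ Z`.
      by_contra! hcon
      have hO' : ∀ n, d n ∈ N → f (d n) ∉ O := fun n hn hO' =>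
        hcon (d n) ⟨hn, hDC (mem_range_self n)⟩ ⟨hO', hnot n⟩
      set S : Set (K × Y) := (fun x => (x, f x)) '' (N ∩ range d)
      have hSΓ : closure S ⊆ Γ :=
        closure_mono (image_mono (inter_subset_right.trans hDC))
      have hSO : closure S ⊆ Prod.snd ⁻¹' Oᶜ := by
        refine closure_minimal ?_ (hO.isClosed_compl.preimage continuous_snd)
        rintro _ ⟨x, ⟨hx, n, rfl⟩, rfl⟩
        exact hO' n hx
      have hfst : l ∈ Prod.fst '' closure S := by
        have hcl : IsClosed (Prod.fst '' closure S) :=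
          (isClosed_closure.isCompact.image continuous_fst).isClosed
        refine closure_minimal ?_ hcl (hDd.open_subset_closure_inter hN hlN)
        exact fun x hx => ⟨(x, f x), subset_closure ⟨x, hx, rfl⟩, rfl⟩
      obtain ⟨⟨l', y⟩, hy, rfl⟩ := hfst
      exact hSO hy (hZO ⟨(l', y), ⟨hSΓ hy, hl, trivial⟩, rfl⟩)

end Scheme

/-- If every point of a non-empty set `L` is approached by points of `C` whose values tend to a
closed set `Z` from outside, there are arbitrarily small open sets accumulating at every point of
`L` such that `f` has disjoint images on their traces on `C`. -/
theorem exists_open_seq_disjoint_images {K Y : Type*} [MetricSpace K] [SecondCountableTopology K]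
    [TopologicalSpace Y] [RegularSpace Y] {f : K → Y} {C : Set K} (hfC : ContinuousOn f C)
    {L : Set K} (hL : L.Nonempty) {Z : Set Y} (hZ : IsClosed Z)
    (h : ∀ l ∈ L, ∀ N : Set K, IsOpen N → l ∈ N → ∀ O : Set Y, IsOpen O → Z ⊆ O →
        ∃ x ∈ N ∩ C, f x ∈ O \ Z)
    {P : Set K} (hP : IsOpen P) (hCP : C ⊆ P) {V : Set K} (hV : IsOpen V) (hLV : L ⊆ V)
    {ε : ℝ} (hε : 0 < ε) :
    ∃ U : ℕ → Set K, (∀ n, IsOpen (U n) ∧ (U n).Nonempty ∧ closure (U n) ⊆ V ∩ P ∧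
        ∀ x ∈ U n, ∀ y ∈ U n, dist x y < ε) ∧
      (∀ m n, m ≠ n → Disjoint (f '' (U m ∩ C)) (f '' (U n ∩ C))) ∧
      ∀ l ∈ L, ∀ N : Set K, IsOpen N → l ∈ N → ∃ n, closure (U n) ⊆ N := by
  obtain ⟨b, hbc, -, hb⟩ := TopologicalSpace.exists_countable_basis K
  obtain ⟨l₀, hl₀⟩ := hL
  have hbne : b.Nonempty := by
    obtain ⟨v, hv, -⟩ := hb.exists_subset_of_mem_open (mem_univ l₀) isOpen_univ
    exact ⟨v, hv⟩
  obtain ⟨e, rfl⟩ := hbc.exists_eq_range hbne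
  -- `O` is a shrinking neighbourhood of `Z`: each new image lies in `O` and misses its successor
  -- `O'`, hence all later images.
  have step : ∀ (n : ℕ) (O : {O : Set Y // IsOpen O ∧ Z ⊆ O}),
      ∃ (U : Set K) (O' : {O : Set Y // IsOpen O ∧ Z ⊆ O}),
        (IsOpen U ∧ U.Nonempty ∧ closure U ⊆ V ∩ P ∧ ∀ x ∈ U, ∀ y ∈ U, dist x y < ε) ∧
        f '' (U ∩ C) ⊆ O.1 ∧ O'.1 ⊆ O.1 ∧ Disjoint (f '' (U ∩ C)) O'.1 ∧
        ((e n ∩ L).Nonempty → closure U ⊆ e n) := by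
    rintro n ⟨O, hO, hZO⟩
    obtain ⟨l, N, hlL, hN, hlN, hNe⟩ : ∃ (l : K) (N : Set K), l ∈ L ∧ IsOpen N ∧ l ∈ N ∧
        ((e n ∩ L).Nonempty → N ⊆ e n) := by
      by_cases hne : (e n ∩ L).Nonempty
      · exact ⟨hne.some, e n, hne.some_mem.2, hb.isOpen (mem_range_self n), hne.some_mem.1,
          fun _ => subset_rfl⟩
      · exact ⟨l₀, univ, hl₀, isOpen_univ, trivial, fun h => absurd h hne⟩
    obtain ⟨x, ⟨⟨hxN, hxV⟩, hxC⟩, hxO, hxZ⟩ :=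
      h l hlL (N ∩ V) (hN.inter hV) ⟨hlN, hLV hlL⟩ O hO hZO
    obtain ⟨W, O', hW, hO', hxW, hZO', hdis⟩ := SeparatedNhds.of_isCompact_isClosed
      (isCompact_singleton (x := f x)) hZ (disjoint_singleton_left.2 hxZ)
    obtain ⟨G, hG, hxG, hGsub⟩ := mem_nhdsWithin.1
      (hfC x hxC ((hO.inter hW).mem_nhds ⟨hxO, hxW rfl⟩))
    have hopen : IsOpen (G ∩ (N ∩ V) ∩ P) := (hG.inter (hN.inter hV)).inter hP
    obtain ⟨δ, hδ, hball⟩ := Metric.nhds_basis_closedBall.mem_iff.1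
      (hopen.mem_nhds ⟨⟨hxG, hxN, hxV⟩, hCP hxC⟩)
    have hcl : closure (Metric.ball x (min δ (ε / 2))) ⊆ G ∩ (N ∩ V) ∩ P :=
      Metric.closure_ball_subset_closedBall.trans
        ((Metric.closedBall_subset_closedBall (min_le_left _ _)).trans hball)
    have himg : f '' (Metric.ball x (min δ (ε / 2)) ∩ C) ⊆ O ∩ W := by
      rintro _ ⟨y, ⟨hy, hyC⟩, rfl⟩
      exact hGsub ⟨(hcl (subset_closure hy)).1.1, hyC⟩
    refine ⟨Metric.ball x (min δ (ε / 2)), ⟨O ∩ O', hO.inter hO', subset_inter hZO hZO'⟩,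
      ⟨Metric.isOpen_ball, ⟨x, Metric.mem_ball_self (lt_min hδ (half_pos hε))⟩,
        fun y hy => ⟨(hcl hy).1.2.2, (hcl hy).2⟩, fun y hy z hz => ?_⟩,
      himg.trans inter_subset_left, inter_subset_left, ?_,
      fun hne y hy => hNe hne (hcl hy).1.2.1⟩
    · have h1 := (Metric.mem_ball.1 hy).trans_le (min_le_right _ _)
      have h2 := (Metric.mem_ball.1 hz).trans_le (min_le_right _ _)
      have h3 := dist_triangle_right y z x
      linarith
    · exact hdis.mono (himg.trans inter_subset_right) inter_subset_right
  choose U O' hU hUO hO'O hdis hacc using step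
  let O : ℕ → {O : Set Y // IsOpen O ∧ Z ⊆ O} :=
    fun n => Nat.rec ⟨univ, isOpen_univ, subset_univ _⟩ O' n
  have hanti : Antitone fun n => (O n).1 := antitone_nat_of_succ_le fun n => hO'O n (O n)
  have hlt : ∀ m n, m < n → Disjoint (f '' (U m (O m) ∩ C)) (f '' (U n (O n) ∩ C)) :=
    fun m n hmn => (hdis m (O m)).mono_right ((hUO n (O n)).trans (hanti hmn))
  refine ⟨fun n => U n (O n), fun n => hU n (O n), fun m n hmn => ?_, fun l hl N hN hlN => ?_⟩
  · rcases hmn.lt_or_gt with h | h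
    · exact hlt m n h
    · exact (hlt n m h).symm
  · obtain ⟨_, ⟨n, rfl⟩, hln, hnN⟩ := hb.exists_subset_of_mem_open hlN hN
    exact ⟨n, (hacc n (O n) ⟨l, hln, hl⟩).trans hnN⟩

theorem proposition5p1 {K : Type*} [TopologicalSpace K] [CompactSpace K] [MetrizableSpace K]
    [Nonempty K] [MeasurableSpace K] [BorelSpace K]
    (𝒦 : Set (Compacts K)) (hher : HereditaryCompacts 𝒦)
    (hi : ∀ V : Set K, IsOpen V → V.Nonempty →
      ∃ A : Compacts K, (A : Set K) ⊆ V ∧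
        ∀ a : ℕ → Compacts K, (∀ n, a n ∈ 𝒦) →
          ∃ L : Compacts K, L ∉ 𝒦 ∧ (L : Set K) ⊆ (A : Set K) \ ⋃ n, (a n : Set K))
    (hii : ∀ A : Compacts K, A ∉ 𝒦 → ¬ CountablyCoveredBy 𝒦 (A : Set K))
    (f : K → unitInterval) (hf : Measurable f) :
    ∃ B : Set K, MeasurableSet B ∧ ¬ CountablyCoveredBy 𝒦 B ∧
      ((∃ c : unitInterval, ∀ x ∈ B, f x = c) ∨ Set.InjOn f B) := by
  let _ : MetricSpace K := metrizableSpaceMetric K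
  by_cases hfib : ∃ c, ¬ CountablyCoveredBy 𝒦 (f ⁻¹' {c})
  · obtain ⟨c, hc⟩ := hfib
    exact ⟨f ⁻¹' {c}, hf (measurableSet_singleton c), hc, .inl ⟨c, fun x hx => hx⟩⟩
  push Not at hfib
  -- The only use of (ii): the empty family covers `∅`.
  have hbot : (⊥ : Compacts K) ∈ 𝒦 := by
    by_contra h
    exact hii ⊥ h ⟨∅, countable_empty, empty_subset _, by simp⟩
  have hmeagre : ∀ c, IsMeagre (f ⁻¹' {c}) := fun c => by
    refine (hfib c).isMeagre hher fun V hV hne => ?_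
    obtain ⟨A, hAV, hA⟩ := hi V hV hne
    obtain ⟨L, hL, hLA⟩ := hA (fun _ => ⊥) fun _ => hbot
    exact ⟨L, hLA.trans (sdiff_subset.trans hAV), hL⟩
  obtain ⟨C, hCG, hCd, hfC⟩ := hf.exists_dense_continuousOn
  have hC : C ∈ residual K := residual_of_dense_Gδ hCG hCd
  obtain ⟨P, hPo, hCP⟩ := hCG.eq_iInter_nat
  have step : ∀ (k : ℕ) (V : {V : Set K // IsOpen V ∧ V.Nonempty}),
      ∃ U : ℕ → {V : Set K // IsOpen V ∧ V.Nonempty},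
        (∀ n, closure (U n).1 ⊆ V.1 ∩ P k ∧
          ∀ x ∈ (U n).1, ∀ y ∈ (U n).1, dist x y < 1 / ((k : ℝ) + 1)) ∧
        (∀ m n, m ≠ n → Disjoint (f '' ((U m).1 ∩ C)) (f '' ((U n).1 ∩ C))) ∧
        ∀ A ∈ 𝒦, ∃ n, Disjoint (closure (U n).1) (A : Set K) := by
    rintro k ⟨V, hV, hne⟩
    obtain ⟨L, Z, hL, hLV, hZ, happ⟩ := exists_compact_approached hne (hi V hV hne) hC hfC hmeagre
    have hsub : ∀ A ∈ 𝒦, ∃ l ∈ L, l ∉ A := fun A hA => by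
      by_contra! hcon
      exact hL (hher A hA L hcon)
    obtain ⟨l, hl, -⟩ := hsub ⊥ hbot
    obtain ⟨U, hU, hdis, hacc⟩ := exists_open_seq_disjoint_images hfC ⟨l, hl⟩ hZ happ (hPo k)
      (hCP ▸ iInter_subset P k) hV hLV (Nat.one_div_pos_of_nat (α := ℝ) (n := k))
    refine ⟨fun n => ⟨U n, (hU n).1, (hU n).2.1⟩, fun n => (hU n).2.2, hdis, fun A hA => ?_⟩
    obtain ⟨l, hl, hlA⟩ := hsub A hA
    obtain ⟨n, hn⟩ := hacc l hl _ A.isCompact.isClosed.isOpen_compl hlA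
    exact ⟨n, disjoint_left.2 fun x hx => hn hx⟩
  choose U hU hdis hacc using step
  -- Lists grow at the head, so the tail of a node is its parent.
  let T : List ℕ → {V : Set K // IsOpen V ∧ V.Nonempty} := fun s =>
    List.rec ⟨univ, isOpen_univ, univ_nonempty⟩ (fun n s V => U s.length V n) s
  have hT : ∀ n s, T (n :: s) = U s.length (T s) n := fun _ _ => rfl
  have hTsub : ∀ n s, closure (T (n :: s)).1 ⊆ (T s).1 ∩ P s.length := fun n s =>
    (hU s.length (T s) n).1
  let B : Set K := ⋂ k : ℕ, ⋃ s : {s : List ℕ // s.length = k}, (T s).1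
  have hB : ∀ {x}, x ∈ B → ∀ k, ∃ s : List ℕ, s.length = k ∧ x ∈ (T s).1 := fun {x} hx k => by
    obtain ⟨⟨s, hs⟩, hxs⟩ := mem_iUnion.1 (mem_iInter.1 hx k)
    exact ⟨s, hs, hxs⟩
  have hBC : B ⊆ C := fun x hx => by
    rw [hCP]
    refine mem_iInter.2 fun k => ?_
    -- Level `k + 1` is the first one contained in `P k`.
    obtain ⟨s, hs, hxs⟩ := hB hx (k + 1)
    obtain ⟨n, t, rfl⟩ := List.exists_cons_of_length_eq_add_one hs
    obtain rfl : t.length = k := by simpa using hs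
    exact (hTsub n t (subset_closure hxs)).2
  refine ⟨B, MeasurableSet.iInter fun k =>
    (isOpen_iUnion fun s : {s : List ℕ // s.length = k} => (T s).2.1).measurableSet, fun hcov => ?_, .inr ?_⟩
  · obtain ⟨a, ha, hBa⟩ := hcov.exists_seq hbot
    choose g hg using fun s : List ℕ => hacc s.length (T s) (a s.length) (ha _)
    let σ : ℕ → List ℕ := fun k => Nat.rec [] (fun _ s => g s :: s) k
    have hσ : ∀ k, σ (k + 1) = g (σ k) :: σ k := fun _ => rfl
    have hlen : ∀ k, (σ k).length = k := fun k => by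
      induction k with
      | zero => rfl
      | succ k ih => rw [hσ, List.length_cons, ih]
    obtain ⟨x, hx⟩ := IsCompact.nonempty_iInter_of_sequence_nonempty_isCompact_isClosed
      (fun k => closure (T (σ k)).1)
      (fun k => (hTsub (g (σ k)) (σ k)).trans (inter_subset_left.trans subset_closure))
      (fun k => (T (σ k)).2.2.closure) isClosed_closure.isCompact fun k => isClosed_closure
    rw [mem_iInter] at hx
    have hxB : x ∈ B := mem_iInter.2 fun k =>
      mem_iUnion.2 ⟨⟨σ k, hlen k⟩, (hTsub _ _ (hx (k + 1))).1⟩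
    obtain ⟨k, hk⟩ := mem_iUnion.1 (hBa hxB)
    refine disjoint_left.1 (hg (σ k)) (hx (k + 1)) ?_
    rwa [hlen]
  · intro x hx y hy hxy
    have hst : ∀ s t : List ℕ, s.length = t.length → x ∈ (T s).1 → y ∈ (T t).1 → s = t := by
      intro s
      induction s with
      | nil => exact fun t ht _ _ => (List.length_eq_zero_iff.1 ht.symm).symm
      | cons m s ih =>
        intro t ht hxs hyt
        obtain ⟨n, t, rfl⟩ := List.exists_cons_of_length_eq_add_one ht.symm
        obtain rfl := ih t (by simpa using ht) (hTsub m s (subset_closure hxs)).1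
          (hTsub n t (subset_closure hyt)).1
        by_contra hne
        have hmn : m ≠ n := fun h => hne (h ▸ rfl)
        exact disjoint_left.1 (hdis s.length (T s) m n hmn) ⟨x, ⟨hxs, hBC hx⟩, rfl⟩
          ⟨y, ⟨hyt, hBC hy⟩, hxy.symm⟩
    refine dist_le_zero.1 (le_of_forall_pos_lt_add fun ε hε => ?_)
    obtain ⟨k, hk⟩ := exists_nat_one_div_lt hε
    obtain ⟨s, hs, hxs⟩ := hB hx (k + 1)
    obtain ⟨t, ht, hyt⟩ := hB hy (k + 1)
    obtain rfl := hst s t (hs.trans ht.symm) hxs hyt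
    obtain ⟨n, u, rfl⟩ := List.exists_cons_of_length_eq_add_one hs
    obtain rfl : u.length = k := by simpa using hs
    rw [zero_add]
    exact ((hU u.length (T u) n).2 x hxs y hyt).trans hk
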